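/- **Theorem 3.1.** Let $\alpha>-1$ and let $H_\alpha$ be the discrete Laguerre operator in $\ell^2(\mathbb N_0)$, that is, $$(H_\alpha u)_n=\sqrt{n(n+\alpha)}\,u_{n-1}+(2n+1+\alpha)\,u_n+\sqrt{(n+1)(n+1+\alpha)}\,u_{n+1},\qquad u_{-1}:=0,$$ on the maximal domain of all $u\in\ell^2(\mathbb N_0)$ for which the right-hand side is again in $\ell^2(\mathbb N_0)$. Then there is a unique strongly continuous one-parameter group of unitary operators on $\ell^2(\mathbb N_0)$ whose infinitesimal generator, with its domain, is $-\mathrm i H_\alpha$; it is denoted by $(\mathrm e^{-\mathrm i tH_\alpha})_{t\in\mathbb R}$. Its kernel $\mathrm e^{-\mathrm i tH_\alpha}(n,m):=\langle \mathrm e^{-\mathrm i tH_\alpha}\delta_n,\delta_m\rangle$, where $\langle\cdot,\cdot\rangle$ is linear in the first entry and $(\delta_n)_{n\ge 0}$ is the standard orthonormal basis, is given by $$\mathrm e^{-\mathrm i tH_\alpha}(n,m)=\mathrm e^{-\mathrm i tH_\alpha}(m,n)=\frac{1}{(1+\mathrm i t)^{1+\alpha}}\left(\frac{t+\mathrm i}{t-\mathrm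 i}\right)^{n}\left(-\frac{t}{t-\mathrm i}\right)^{m-n}\sqrt{\frac{(\alpha+1)_m\,n!}{(\alpha+1)_n\,m!}}\;P_n^{(\alpha,m-n)}\!\left(\frac{t^2-1}{t^2+1}\right)$$ for all $t\in\mathbb R$ and all $n,m\in\mathbb N_0$. Here the power $(1+\mathrm i t)^{1+\alpha}$ is the principal one, $(x)_n=x(x+1)\cdots(x+n-1)$ with $(x)_0=1$ is the Pochhammer symbol, and, for arbitrary real $\alpha,\beta$, $$P_n^{(\alpha,\beta)}(x)=\sum_{k=0}^n\binom{n+\alpha}{n-k}\binom{n+\beta}{k}\left(\frac{x-1}{2}\right)^k\left(\frac{x+1}{2}\right)^{n-k},\qquad \binom{y}{k}=\frac{y(y-1)\cdots(y-k+1)}{k!},$$ is the Jacobi polynomial. For $t=0$, one puts $0^0=1$ if $m=n$, and for $m<n$ (a negative power of $0$ times a vanishing Jacobi polynomial) the right-hand side is read as $0$, which is its limit as $t\to0$. -/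

import Mathlib

open scoped InnerProductSpace

noncomputable section

/-- The complex Hilbert space `ℓ²(ℕ₀)`. -/
abbrev EllTwo : Type := lp (fun _ : ℕ => ℂ) 2

/-- The Pochhammer symbol `(x)_n = x (x + 1) ⋯ (x + n - 1)`, with `(x)_0 = 1`. -/
def pochhammerSymbol (x : ℝ) (n : ℕ) : ℝ :=
  ∏ j ∈ Finset.range n, (x + j)

/-- The binomial coefficient with real upper entry,
`x (x - 1) ⋯ (x - k + 1) / k! = (x - k + 1)_k / k!`. -/
def realBinom (x : ℝ) (k : ℕ) : ℝ :=
  pochhammerSymbol (x - k + 1) k / (Nat.factorial k : ℝ)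

/-- The Jacobi polynomial `P_n^{(α,β)}(x)` for arbitrary real parameters `α`, `β`. -/
def jacobiP (n : ℕ) (α β x : ℝ) : ℝ :=
  ∑ k ∈ Finset.range (n + 1),
    realBinom (n + α) (n - k) * realBinom (n + β) k *
      ((x - 1) / 2) ^ k * ((x + 1) / 2) ^ (n - k)

/-- The discrete Laguerre difference expression `τ_α` on all sequences, with `u_{-1} = 0`. -/
def laguerreExpr (α : ℝ) : (ℕ → ℂ) →ₗ[ℂ] (ℕ → ℂ) where
  toFun u := fun n =>
    (match n with
      | 0 => 0
      | k + 1 => (Real.sqrt (((k + 1 : ℕ) : ℝ) * (((k + 1 : ℕ) : ℝ) + α)) : ℂ) * u k)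
    + ((2 * (n : ℝ) + 1 + α : ℝ) : ℂ) * u n
    + (Real.sqrt (((n : ℝ) + 1) * ((n : ℝ) + 1 + α)) : ℂ) * u (n + 1)
  map_add' u v := by
    funext n
    cases n <;> simp only [Pi.add_apply] <;> ring
  map_smul' c u := by
    funext n
    cases n <;> simp only [Pi.smul_apply, smul_eq_mul, RingHom.id_apply] <;> ring

/-- The discrete Laguerre operator `H_α` in `ℓ²(ℕ₀)`: it acts as `τ_α` on its maximal domain
`{u ∈ ℓ² : τ_α u ∈ ℓ²}`. -/
def laguerreOp (α : ℝ) : EllTwo →ₗ.[ℂ] EllTwo where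
  domain :=
    { carrier := {u | Memℓp (laguerreExpr α (fun n => u n)) 2}
      zero_mem' := by
        have h : laguerreExpr α (fun n => (0 : EllTwo) n) = 0 :=
          (laguerreExpr α).map_zero
        rw [Set.mem_ofPred_eq, h]
        exact zero_memℓp
      add_mem' := by
        intro u v hu hv
        have h : laguerreExpr α (fun n => (u + v) n)
            = laguerreExpr α (fun n => u n) + laguerreExpr α (fun n => v n) :=
          (laguerreExpr α).map_add _ _
        rw [Set.mem_ofPred_eq, h]
        exact Memℓp.add hu hv
      smul_mem' := by
        intro c u hu
        have h : laguerreExpr α (fun n => (c • u) n)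
            = c • laguerreExpr α (fun n => u n) :=
          (laguerreExpr α).map_smul _ _
        rw [Set.mem_ofPred_eq, h]
        exact Memℓp.const_smul hu c }
  toFun :=
    { toFun := fun u => ⟨laguerreExpr α (fun n => (u : EllTwo) n), u.2⟩
      map_add' := fun u v => Subtype.ext ((laguerreExpr α).map_add _ _)
      map_smul' := fun c u => Subtype.ext ((laguerreExpr α).map_smul _ _) }

/-- `U` is the evolution group `t ↦ e^{-itA}` of the operator `A` (in the sense of Stone's
theorem): a strongly continuous one-parameter group of unitary operators whose infinitesimal
generator, with its exact domain, is `-iA`. That is, `u ∈ dom A` and `A u = v` hold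
if and only if `t ↦ U t u` is differentiable at `0` with derivative `-i v`. -/
structure IsEvolutionGroup {E : Type*} [NormedAddCommGroup E] [InnerProductSpace ℂ E]
    [CompleteSpace E] (A : E →ₗ.[ℂ] E) (U : ℝ → E →L[ℂ] E) : Prop where
  map_zero : U 0 = 1
  map_add : ∀ s t : ℝ, U (s + t) = U s * U t
  unitary : ∀ t : ℝ, U t ∈ unitary (E →L[ℂ] E)
  continuous : ∀ u : E, Continuous fun t : ℝ => U t u
  generator : ∀ u v : E,
    (u, v) ∈ A.graph ↔ HasDerivAt (fun t : ℝ => U t u) (-(Complex.I • v)) 0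

/-- The standard unit vector `δ_n` of `ℓ²(ℕ₀)`. -/
def delta (n : ℕ) : EllTwo := lp.single 2 n 1

/-- The kernel (matrix entry) `B(n,m) = ⟨B δ_n, δ_m⟩`, where `⟨·,·⟩` is linear in the first
entry; Mathlib's inner product is linear in the second entry. -/
def kernel (B : EllTwo →L[ℂ] EllTwo) (n m : ℕ) : ℂ := ⟪delta m, B (delta n)⟫_ℂ

end

noncomputable section

/-! The kernel is written down explicitly, and the unitary group is built from it. With `c k =
√((α+1)_k / k!)`, the expression `τ_α` sends the sequence `c k * z ^ k` to its image under `(1+z)²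
d/dz + (1+α)(1+z)`, so the Schrödinger equation moves `z` along `z' = -i(1+z)²` and multiplies by a
scalar. The orbit of `0` is `r(t) = -t/(t-i)`, the scalar is `(1+it)^(-(1+α))`, and column `n`
carries the polynomial `meixnerSum` in `r`. `meixnerSum_recurrence` makes every column a solution
coordinatewise (`hasDerivAt_laguerreKernel`).

Since `|r(t)| < 1` locally uniformly, columns decay geometrically. Hence they are differentiable in
norm, and summation by parts against any vector of the maximal domain leaves no boundary term
(`inner_laguerreExpr`). The inner product of two columns is therefore constant along the flow
(`inner_laguerreColumn`), which yields both orthonormality and the group law; unitarity follows from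
`star_laguerreEvolution`. Pairing with columns also identifies the generator on the whole maximal
domain, without a separate proof of self-adjointness.

Two groups with the same generator agree on its domain (`eq_on_domain`), which contains every `delta
n`, so they are equal. The Jacobi formula is a termwise rewriting of `meixnerSum`
(`laguerreKernel_eq_jacobi`). -/

/-! ### Pochhammer symbols and binomial coefficients -/

theorem pochhammerSymbol_succ (x : ℝ) (n : ℕ) :
    pochhammerSymbol x (n + 1) = pochhammerSymbol x n * (x + n) :=
  Finset.prod_range_succ _ _

theorem pochhammerSymbol_pos {x : ℝ} (hx : 0 < x) (n : ℕ) : 0 < pochhammerSymbol x n :=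
  Finset.prod_pos fun _ _ => by positivity

theorem pochhammerSymbol_add (x : ℝ) (k j : ℕ) :
    pochhammerSymbol x (k + j) = pochhammerSymbol x k * pochhammerSymbol (x + k) j := by
  simp only [pochhammerSymbol, Finset.prod_range_add, Nat.cast_add, add_assoc]

theorem realBinom_natCast (m k : ℕ) : realBinom m k = m.choose k := by
  have hk : (k.factorial : ℝ) ≠ 0 := by positivity
  rw [realBinom, div_eq_iff hk, mul_comm, ← Nat.cast_mul, ← Nat.descFactorial_eq_factorial_mul_choose]
  rcases le_or_gt k m with h | h
  · rw [Nat.descFactorial_eq_prod_range, Nat.cast_prod, pochhammerSymbol, ← Finset.prod_range_reflect]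
    refine Finset.prod_congr rfl fun j hj => ?_
    have hj := Finset.mem_range.1 hj
    rw [Nat.sub_sub, Nat.cast_sub (by omega), Nat.cast_sub (by omega)]
    push_cast
    ring
  · rw [Nat.descFactorial_of_lt h, Nat.cast_zero, pochhammerSymbol]
    -- The factor `m - k + 1 + j` vanishes at this `j`.
    refine Finset.prod_eq_zero (i := k - 1 - m) (Finset.mem_range.2 (by omega)) ?_
    rw [Nat.cast_sub (by omega), Nat.cast_sub (by omega)]
    push_cast
    ring

/-! ### Coherent-state weights -/

/-- The weight `√((α+1)_n / n!)`, the coefficients of the coherent states `∑ cₙ zⁿ δₙ`. -/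
def laguerreNorm (α : ℝ) (n : ℕ) : ℝ :=
  Real.sqrt (pochhammerSymbol (α + 1) n / n.factorial)

theorem laguerreNorm_pos {α : ℝ} (hα : -1 < α) (n : ℕ) : 0 < laguerreNorm α n :=
  Real.sqrt_pos.2 (div_pos (pochhammerSymbol_pos (by linarith) n) (by positivity))

theorem laguerreNorm_sq {α : ℝ} (hα : -1 < α) (n : ℕ) :
    laguerreNorm α n ^ 2 = pochhammerSymbol (α + 1) n / n.factorial :=
  Real.sq_sqrt (div_pos (pochhammerSymbol_pos (by linarith) n) (by positivity)).le

theorem laguerreNorm_succ {α : ℝ} (hα : -1 < α) (n : ℕ) :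
    laguerreNorm α (n + 1) * Real.sqrt (n + 1) = laguerreNorm α n * Real.sqrt (n + 1 + α) := by
  have h := pochhammerSymbol_pos (show 0 < α + 1 by linarith) n
  have h' := pochhammerSymbol_pos (show 0 < α + 1 by linarith) (n + 1)
  rw [laguerreNorm, laguerreNorm, ← Real.sqrt_mul (by positivity), ← Real.sqrt_mul (by positivity)]
  congr 1
  rw [pochhammerSymbol_succ, Nat.factorial_succ]
  push_cast
  field_simp
  ring

theorem sqrt_mul_laguerreNorm_succ {α : ℝ} (hα : -1 < α) (n : ℕ) :
    Real.sqrt ((n + 1) * (n + 1 + α)) * laguerreNorm α (n + 1) =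
      (n + 1 + α) * laguerreNorm α n := by
  have h : (0 : ℝ) ≤ n + 1 + α := by have : (0 : ℝ) ≤ n := n.cast_nonneg; linarith
  rw [Real.sqrt_mul (by positivity)]
  calc _ = laguerreNorm α (n + 1) * Real.sqrt (n + 1) * Real.sqrt (n + 1 + α) := by ring
    _ = laguerreNorm α n * (Real.sqrt (n + 1 + α) * Real.sqrt (n + 1 + α)) := by
      rw [laguerreNorm_succ hα]; ring
    _ = _ := by rw [Real.mul_self_sqrt h]; ring

theorem sqrt_mul_laguerreNorm {α : ℝ} (hα : -1 < α) (n : ℕ) :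
    Real.sqrt ((n + 1) * (n + 1 + α)) * laguerreNorm α n =
      (n + 1) * laguerreNorm α (n + 1) := by
  have h : (0 : ℝ) ≤ n + 1 := by positivity
  rw [Real.sqrt_mul (by positivity)]
  calc _ = laguerreNorm α n * Real.sqrt (n + 1 + α) * Real.sqrt (n + 1) := by ring
    _ = laguerreNorm α (n + 1) * (Real.sqrt (n + 1) * Real.sqrt (n + 1)) := by
      rw [← laguerreNorm_succ hα]; ring
    _ = _ := by rw [Real.mul_self_sqrt h]; ring

/-! ### The Meixner-type polynomial and its recurrence -/

/-- The weights `C(n,k) C(m,k) k! / (α+1)_k`. -/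
def meixnerWeight (α : ℝ) (n m k : ℕ) : ℝ :=
  n.choose k * m.choose k * (k.factorial / pochhammerSymbol (α + 1) k)

theorem meixnerWeight_comm (α : ℝ) (n m k : ℕ) :
    meixnerWeight α n m k = meixnerWeight α m n k := by
  rw [meixnerWeight, meixnerWeight, mul_comm (n.choose k : ℝ)]

theorem meixnerWeight_of_lt (α : ℝ) (n : ℕ) {m k : ℕ} (h : m < k) :
    meixnerWeight α n m k = 0 := by
  simp [meixnerWeight, Nat.choose_eq_zero_of_lt h]

theorem meixnerWeight_zero (α : ℝ) (n m : ℕ) : meixnerWeight α n m 0 = 1 := by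
  simp [meixnerWeight, pochhammerSymbol]

theorem meixnerWeight_nonneg {α : ℝ} (hα : -1 < α) (n m k : ℕ) : 0 ≤ meixnerWeight α n m k :=
  mul_nonneg (by positivity)
    (div_nonneg (by positivity) (pochhammerSymbol_pos (by linarith) k).le)

theorem meixnerWeight_succ_right {α : ℝ} (n m k : ℕ) :
    ((m : ℝ) + 1) * meixnerWeight α n m k = ((m : ℝ) + 1 - k) * meixnerWeight α n (m + 1) k := by
  rcases le_or_gt k m with h | h
  · have h' : (m.choose k : ℝ) * (m + 1) = (m + 1).choose k * ((m : ℝ) + 1 - k) := by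
      have := Nat.choose_mul_succ_eq m k
      rw [← Nat.cast_add_one, ← Nat.cast_sub (by omega)]
      exact_mod_cast this
    rw [meixnerWeight, meixnerWeight]
    linear_combination (n.choose k * (k.factorial / pochhammerSymbol (α + 1) k)) * h'
  · rw [meixnerWeight_of_lt _ _ h]
    rcases (Nat.succ_le_iff.2 h).eq_or_lt with rfl | h
    · push_cast; ring
    · rw [meixnerWeight_of_lt _ _ h]; ring

/-- The three-term relation behind the index shift in `meixnerSum_recurrence`. -/
theorem meixnerWeight_shift {α : ℝ} (hα : -1 < α) (n m k : ℕ) :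
    ((m : ℝ) + 1 + α) * (meixnerWeight α n (m + 1) (k + 1) - meixnerWeight α n m (k + 1)) -
      (k + 1) * meixnerWeight α n m (k + 1) = ((n : ℝ) - k) * meixnerWeight α n m k := by
  have hn : ((n.choose (k + 1) : ℝ)) * (k + 1) = n.choose k * ((n : ℝ) - k) := by
    rcases le_or_gt k n with h | h
    · rw [← Nat.cast_sub h]; exact_mod_cast Nat.choose_succ_right_eq n k
    · simp [Nat.choose_eq_zero_of_lt h, Nat.choose_eq_zero_of_lt (h.trans (Nat.lt_succ_self k))]
  have hm : ((m.choose (k + 1) : ℝ)) * (k + 1) = m.choose k * ((m : ℝ) - k) := by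
    rcases le_or_gt k m with h | h
    · rw [← Nat.cast_sub h]; exact_mod_cast Nat.choose_succ_right_eq m k
    · simp [Nat.choose_eq_zero_of_lt h, Nat.choose_eq_zero_of_lt (h.trans (Nat.lt_succ_self k))]
  have hp := pochhammerSymbol_pos (show 0 < α + 1 by linarith) k
  have hk : 0 < α + 1 + k := by have : (0 : ℝ) ≤ k := k.cast_nonneg; linarith
  simp only [meixnerWeight, Nat.choose_succ_succ, pochhammerSymbol_succ, Nat.factorial_succ]
  push_cast
  field_simp
  linear_combination (m.choose k : ℝ) * (α + 1 + k) * hn - n.choose (k+1) * (k+1)* hm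

/-- The finite sum `∑ k, C(n,k) C(m,k) k! / (α+1)_k r^(n+m-2k) (1+r)^(2k)`. -/
def meixnerSum (α : ℝ) (n m : ℕ) (r : ℂ) : ℂ :=
  ∑ k ∈ Finset.range (n + 1),
    (meixnerWeight α n m k : ℂ) * (r ^ (n - k) * r ^ (m - k) * ((1 + r) ^ 2) ^ k)

theorem meixnerSum_eq_of_lt (α : ℝ) {n m N : ℕ} (h : n < N) (r : ℂ) :
    meixnerSum α n m r = ∑ k ∈ Finset.range N,
      (meixnerWeight α n m k : ℂ) * (r ^ (n - k) * r ^ (m - k) * ((1 + r) ^ 2) ^ k) := by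
  refine Finset.sum_subset (fun k hk => ?_) (fun k _ hk => ?_)
  · simp only [Finset.mem_range] at *; omega
  · rw [Finset.mem_range, not_lt] at hk
    rw [meixnerWeight_comm, meixnerWeight_of_lt _ _ (by omega)]; simp

theorem meixnerSum_comm (α : ℝ) (n m : ℕ) (r : ℂ) :
    meixnerSum α n m r = meixnerSum α m n r := by
  rw [meixnerSum_eq_of_lt α (show n < n + m + 1 by omega),
    meixnerSum_eq_of_lt α (show m < n + m + 1 by omega)]
  refine Finset.sum_congr rfl fun k _ => ?_
  rw [meixnerWeight_comm, mul_comm (r ^ (n - k))]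

/-- The derivative of `meixnerSum` in `r`. -/
def meixnerSumDeriv (α : ℝ) (n m : ℕ) (r : ℂ) : ℂ :=
  ∑ k ∈ Finset.range (n + 1), (meixnerWeight α n m k : ℂ) *
    (((n - k : ℕ) * r ^ (n - k - 1) * r ^ (m - k) +
      r ^ (n - k) * ((m - k : ℕ) * r ^ (m - k - 1))) * ((1 + r) ^ 2) ^ k +
      r ^ (n - k) * r ^ (m - k) * (k * ((1 + r) ^ 2) ^ (k - 1) * (2 * (1 + r))))

theorem hasDerivAt_meixnerSum (α : ℝ) (n m : ℕ) (r : ℂ) :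
    HasDerivAt (meixnerSum α n m) (meixnerSumDeriv α n m r) r := by
  unfold meixnerSum meixnerSumDeriv
  refine HasDerivAt.fun_sum fun k _ => HasDerivAt.const_mul _ ?_
  have h2 : HasDerivAt (fun r : ℂ => (1 + r) ^ 2) (2 * (1 + r)) r := by
    simpa using ((hasDerivAt_id r).const_add 1).fun_pow 2
  exact ((hasDerivAt_pow _ r).fun_mul (hasDerivAt_pow _ r)).fun_mul (h2.fun_pow k)

/-- After the weights `laguerreNorm` are removed, the right side is `τ_α` in the index `m`.
Differentiating `r ^ (m-k)` and `(1+r) ^ (2k)` reproduces it term by term up to a remainder `G`;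
differentiating `r ^ (n-k)` gives terms `F` with one surplus factor `(1+r)²`. Shifting `k` by one
matches `F` with `G`, by `meixnerWeight_shift`. -/
theorem meixnerSum_recurrence {α : ℝ} (hα : -1 < α) (n m : ℕ) (r : ℂ) :
    (1 + r) ^ 2 * meixnerSumDeriv α n m r + (1 + α) * (1 + r) * meixnerSum α n m r =
      m * meixnerSum α n (m - 1) r + (2 * m + 1 + α) * meixnerSum α n m r +
        (m + 1 + α) * meixnerSum α n (m + 1) r := by
  set F : ℕ → ℂ := fun k => (meixnerWeight α n m k : ℂ) *
    ((n - k : ℕ) * r ^ (n - k - 1) * r ^ (m - k) * ((1 + r) ^ 2) ^ (k + 1)) with hF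
  set G : ℕ → ℂ := fun k =>
    (((m : ℝ) + 1 + α) * (meixnerWeight α n (m + 1) k - meixnerWeight α n m k) -
      k * meixnerWeight α n m k : ℝ) * (r ^ (n - k) * r ^ (m + 1 - k) * ((1 + r) ^ 2) ^ k) with hG
  have hFG : ∑ k ∈ Finset.range (n + 1), F k = ∑ k ∈ Finset.range (n + 1), G k := by
    rw [Finset.sum_range_succ, Finset.sum_range_succ']
    have h0 : G 0 = 0 := by simp [hG, meixnerWeight_zero]
    have hn : F n = 0 := by simp [hF]
    rw [h0, hn]
    congr 1
    refine Finset.sum_congr rfl fun k hk => ?_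
    have hk : k ≤ n := (Finset.mem_range.1 hk).le
    have h := meixnerWeight_shift hα n m k
    simp only [hF, hG]
    rw [Nat.cast_add, Nat.cast_one, h, ← Nat.cast_sub hk, Nat.add_sub_add_right, Nat.sub_sub]
    push_cast
    ring
  simp only [meixnerSum, meixnerSumDeriv, Finset.mul_sum, ← Finset.sum_add_distrib]
  rw [← sub_eq_zero, ← Finset.sum_sub_distrib]
  rw [← sub_eq_zero, ← Finset.sum_sub_distrib] at hFG
  rw [← hFG]
  refine Finset.sum_congr rfl fun k hk => ?_
  simp only [hF, hG]
  have hq : (k : ℂ) * ((1 + r) ^ 2) ^ (k - 1) * (1 + r) ^ 2 = k * ((1 + r) ^ 2) ^ k := by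
    rcases k with _ | k
    · simp
    · simp [pow_succ]; ring
  rcases le_or_gt k m with h | h
  · obtain ⟨j, rfl⟩ := Nat.exists_eq_add_of_le h
    have h1 : k + j - k = j := by omega
    have h2 : k + j + 1 - k = j + 1 := by omega
    rw [h1, h2]
    rcases j with _ | j
    · have h0 : ((k + 0 : ℕ) : ℂ) * meixnerWeight α n (k + 0 - 1) k = 0 := by
        rcases k with _ | k
        · simp
        · rw [meixnerWeight_of_lt _ n (by omega)]; simp
      push_cast at h0 ⊢
      linear_combination (meixnerWeight α n (k + 0) k : ℂ) * (r ^ (n - k) * 2 * (1 + r)) * hq -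
        r ^ (n - k) * r ^ (k + 0 - 1 - k) * ((1 + r) ^ 2) ^ k * h0
    · have h1 : k + (j + 1) - 1 - k = j := by omega
      have hw := congrArg (fun x : ℝ => (x : ℂ)) (meixnerWeight_succ_right (α := α) n (k + j) k)
      have h3 : k + (j + 1) - 1 = k + j := by omega
      rw [h3, Nat.add_sub_cancel_left, Nat.add_sub_cancel]
      simp only [← add_assoc]
      push_cast at hw ⊢
      linear_combination (meixnerWeight α n (k + j + 1) k : ℂ) *
        (r ^ (n - k) * r ^ (j + 1) * 2 * (1 + r)) * hq -
        r ^ (n - k) * r ^ j * ((1 + r) ^ 2) ^ k * hw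
  · rw [meixnerWeight_of_lt _ n h, meixnerWeight_of_lt α n (show m - 1 < k by omega)]
    push_cast; ring

/-! ### The orbit and the scalar factor -/

/-- The orbit of `0` under the flow `z' = -i (1 + z)²`. -/
def laguerreOrbit (t : ℝ) : ℂ := -((t : ℂ) / ((t : ℂ) - Complex.I))

theorem ofReal_sub_I_ne_zero (t : ℝ) : (t : ℂ) - Complex.I ≠ 0 := fun h => by
  simpa using congrArg Complex.im h

theorem one_add_I_mul_ne_zero (t : ℝ) : 1 + Complex.I * (t : ℂ) ≠ 0 := fun h => by
  simpa using congrArg Complex.re h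

theorem one_add_I_mul_mem_slitPlane (t : ℝ) : 1 + Complex.I * (t : ℂ) ∈ Complex.slitPlane :=
  Or.inl (by simp)

theorem one_add_laguerreOrbit (t : ℝ) :
    1 + laguerreOrbit t = -Complex.I / ((t : ℂ) - Complex.I) := by
  have := ofReal_sub_I_ne_zero t
  rw [laguerreOrbit]
  field_simp
  ring

theorem one_add_laguerreOrbit_mul (t : ℝ) :
    (1 + laguerreOrbit t) * (1 + Complex.I * t) = 1 := by
  have := ofReal_sub_I_ne_zero t
  rw [one_add_laguerreOrbit, div_mul_eq_mul_div, div_eq_one_iff_eq this]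
  linear_combination -(t : ℂ) * Complex.I_sq

theorem hasDerivAt_laguerreOrbit (t : ℝ) :
    HasDerivAt laguerreOrbit (-(Complex.I * (1 + laguerreOrbit t) ^ 2)) t := by
  have h0 := ofReal_sub_I_ne_zero t
  have h : HasDerivAt (fun z : ℂ => -(z / (z - Complex.I)))
      (-((1 * ((t : ℂ) - Complex.I) - t * 1) / ((t : ℂ) - Complex.I) ^ 2)) t :=
    ((hasDerivAt_id (t : ℂ)).fun_div ((hasDerivAt_id (t : ℂ)).sub_const _) h0).fun_neg
  refine h.comp_ofReal.congr_deriv ?_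
  rw [one_add_laguerreOrbit]
  field_simp
  linear_combination Complex.I * Complex.I_sq

theorem hasDerivAt_one_add_I_mul_cpow (c : ℂ) (t : ℝ) :
    HasDerivAt (fun t : ℝ => (1 + Complex.I * (t : ℂ)) ^ (-c))
      (-(Complex.I * (c * (1 + laguerreOrbit t) * (1 + Complex.I * t) ^ (-c)))) t := by
  have h : HasDerivAt (fun z : ℂ => (1 + Complex.I * z) ^ (-c))
      (-c * (1 + Complex.I * t) ^ (-c - 1) * (Complex.I * 1)) t :=
    (((hasDerivAt_id (t : ℂ)).const_mul Complex.I).const_add 1).cpow_const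
      (one_add_I_mul_mem_slitPlane t)
  convert h.comp_ofReal using 1
  rw [Complex.cpow_sub _ _ (one_add_I_mul_ne_zero t), Complex.cpow_one,
    eq_div_of_mul_eq (one_add_I_mul_ne_zero t) (one_add_laguerreOrbit_mul t)]
  ring

/-! ### The kernel and its symmetries -/

/-- The explicit kernel of the evolution group of the discrete Laguerre operator. -/
def laguerreKernel (α t : ℝ) (n m : ℕ) : ℂ :=
  (1 + Complex.I * (t : ℂ)) ^ (-((1 + α : ℝ) : ℂ)) * laguerreNorm α n * laguerreNorm α m *
    meixnerSum α n m (laguerreOrbit t)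

theorem laguerreKernel_comm (α t : ℝ) (n m : ℕ) :
    laguerreKernel α t n m = laguerreKernel α t m n := by
  rw [laguerreKernel, laguerreKernel, meixnerSum_comm]
  ring

theorem conj_laguerreOrbit (t : ℝ) :
    (starRingEnd ℂ) (laguerreOrbit t) = laguerreOrbit (-t) := by
  have h := ofReal_sub_I_ne_zero (-t)
  have h' : (t : ℂ) + Complex.I ≠ 0 := fun h' => h (by push_cast; linear_combination -h')
  simp only [laguerreOrbit, map_neg, map_div₀, map_sub, Complex.conj_ofReal, Complex.conj_I,
    Complex.ofReal_neg, sub_neg_eq_add]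
  rw [← neg_add', div_neg, neg_div, neg_neg]

theorem conj_laguerreKernel (α t : ℝ) (n m : ℕ) :
    (starRingEnd ℂ) (laguerreKernel α t n m) = laguerreKernel α (-t) n m := by
  have h1 : (starRingEnd ℂ) ((1 + Complex.I * (t : ℂ)) ^ (-((1 + α : ℝ) : ℂ))) =
      (1 + Complex.I * ((-t : ℝ) : ℂ)) ^ (-((1 + α : ℝ) : ℂ)) := by
    have h := Complex.conj_cpow (1 + Complex.I * (t : ℂ)) (-((1 + α : ℝ) : ℂ))
      (Complex.slitPlane_arg_ne_pi (one_add_I_mul_mem_slitPlane t))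
    rw [map_neg, Complex.conj_ofReal] at h
    rw [← h]
    simp
  have h2 : (starRingEnd ℂ) (meixnerSum α n m (laguerreOrbit t)) =
      meixnerSum α n m (laguerreOrbit (-t)) := by
    simp only [meixnerSum, map_sum, map_mul, map_pow, map_add, map_one, Complex.conj_ofReal,
      conj_laguerreOrbit]
  simp only [laguerreKernel, map_mul, h1, h2, Complex.conj_ofReal]

theorem laguerreKernel_zero {α : ℝ} (hα : -1 < α) (n m : ℕ) :
    laguerreKernel α 0 n m = if n = m then 1 else 0 := by
  have h0 : laguerreOrbit 0 = 0 := by simp [laguerreOrbit]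
  -- At `r = 0` the factor `r ^ (n-k)` leaves only `k = n`, and `r ^ (m-n)` then forces `m ≤ n`.
  rw [laguerreKernel, h0, meixnerSum, Finset.sum_range_succ, Finset.sum_eq_zero]
  · rcases eq_or_ne n m with rfl | hnm
    · have h := laguerreNorm_sq hα n
      have hp := pochhammerSymbol_pos (show 0 < α + 1 by linarith) n
      have h' : laguerreNorm α n * laguerreNorm α n * meixnerWeight α n n n = 1 := by
        rw [← sq, h, meixnerWeight, Nat.choose_self]
        field_simp
        simp
      rw [if_pos rfl]
      simpa [mul_assoc] using congrArg (fun x : ℝ => (x : ℂ)) h'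
    · rw [if_neg hnm]
      rcases lt_or_ge m n with h | h
      · simp [meixnerWeight_of_lt _ _ h]
      · have : m - n ≠ 0 := by omega
        simp [this]
  · intro k hk
    have : n - k ≠ 0 := by have := Finset.mem_range.1 hk; omega
    simp [this]

/-! ### The kernel solves the Schrödinger equation -/

theorem laguerreExpr_zero (α : ℝ) (u : ℕ → ℂ) :
    laguerreExpr α u 0 = ((2 * ((0 : ℕ) : ℝ) + 1 + α : ℝ) : ℂ) * u 0
      + (Real.sqrt ((((0 : ℕ) : ℝ) + 1) * (((0 : ℕ) : ℝ) + 1 + α)) : ℂ) * u 1 := by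
  simp [laguerreExpr]

theorem laguerreExpr_succ (α : ℝ) (u : ℕ → ℂ) (k : ℕ) :
    laguerreExpr α u (k + 1) = (Real.sqrt (((k : ℝ) + 1) * ((k : ℝ) + 1 + α)) : ℂ) * u k +
      ((2 * ((k + 1 : ℕ) : ℝ) + 1 + α : ℝ) : ℂ) * u (k + 1)
      + (Real.sqrt ((((k + 1 : ℕ) : ℝ) + 1) * (((k + 1 : ℕ) : ℝ) + 1 + α)) : ℂ) * u (k + 2) := by
  simp [laguerreExpr]

theorem laguerreExpr_laguerreNorm_mul {α : ℝ} (hα : -1 < α) (f : ℕ → ℂ) (m : ℕ) :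
    laguerreExpr α (fun k => laguerreNorm α k * f k) m =
      laguerreNorm α m * (m * f (m - 1) + (2 * m + 1 + α) * f m + (m + 1 + α) * f (m + 1)) := by
  have h1 (k : ℕ) := congrArg (fun x : ℝ => (x : ℂ)) (sqrt_mul_laguerreNorm_succ hα k)
  have h2 (k : ℕ) := congrArg (fun x : ℝ => (x : ℂ)) (sqrt_mul_laguerreNorm hα k)
  simp only [Complex.ofReal_mul, Complex.ofReal_add, Complex.ofReal_natCast, Complex.ofReal_one]
    at h1 h2
  rcases m with _ | k
  · have := h1 0
    rw [laguerreExpr_zero]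
    push_cast at this ⊢
    linear_combination f 1 * this
  · have h1 := h1 (k + 1)
    have h2 := h2 k
    rw [laguerreExpr_succ, Nat.add_sub_cancel]
    push_cast at h1 h2 ⊢
    linear_combination f (k + 2) * h1 + f k * h2

theorem hasDerivAt_laguerreKernel {α : ℝ} (hα : -1 < α) (t : ℝ) (n m : ℕ) :
    HasDerivAt (fun t => laguerreKernel α t n m)
      (-(Complex.I * laguerreExpr α (laguerreKernel α t n) m)) t := by
  have hS := (hasDerivAt_meixnerSum α n m (laguerreOrbit t)).scomp t (hasDerivAt_laguerreOrbit t)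
  have hA := hasDerivAt_one_add_I_mul_cpow ((1 + α : ℝ) : ℂ) t
  refine (((hA.mul_const (laguerreNorm α n : ℂ)).mul_const
    (laguerreNorm α m : ℂ)).fun_mul hS).congr_deriv ?_
  have hK : laguerreKernel α t n = ((1 + Complex.I * (t : ℂ)) ^ (-((1 + α : ℝ) : ℂ)) *
      laguerreNorm α n) • fun k => laguerreNorm α k * meixnerSum α n k (laguerreOrbit t) := by
    funext k
    simp only [laguerreKernel, Pi.smul_apply, smul_eq_mul]
    ring
  have hrec := meixnerSum_recurrence hα n m (laguerreOrbit t)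
  rw [hK, LinearMap.map_smul, Pi.smul_apply, laguerreExpr_laguerreNorm_mul hα, ← hrec]
  simp only [Function.comp, smul_eq_mul]
  push_cast
  ring

/-! ### Decay of the kernel -/

/-- Exactly, `|r(t)|² = t²/(1+t²)`. The weaker bound stays positive at `R = 0`, which allows
division by its powers later. -/
theorem norm_laguerreOrbit_le {t R : ℝ} (ht : |t| ≤ R) :
    ‖laguerreOrbit t‖ ≤ Real.sqrt ((1 + R ^ 2) / (2 + R ^ 2)) := by
  have h2 : t ^ 2 ≤ R ^ 2 := sq_le_sq' (abs_le.1 ht).1 (abs_le.1 ht).2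
  refine Real.le_sqrt_of_sq_le ?_
  rw [laguerreOrbit, norm_neg, norm_div, div_pow, ← Complex.normSq_eq_norm_sq,
    ← Complex.normSq_eq_norm_sq, Complex.normSq_apply, Complex.normSq_apply]
  simp only [Complex.ofReal_re, Complex.ofReal_im, Complex.sub_re, Complex.sub_im, Complex.I_re,
    Complex.I_im]
  rw [div_le_div_iff₀ (by nlinarith [sq_nonneg t]) (by positivity)]
  nlinarith

theorem norm_one_add_I_mul_cpow_le {α : ℝ} (hα : -1 < α) (t : ℝ) :
    ‖(1 + Complex.I * (t : ℂ)) ^ (-((1 + α : ℝ) : ℂ))‖ ≤ 1 := by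
  rw [← Complex.ofReal_neg, Complex.norm_cpow_real]
  refine Real.rpow_le_one_of_one_le_of_nonpos ?_ (by linarith)
  simpa using Complex.abs_re_le_norm (1 + Complex.I * (t : ℂ))

/-- Consecutive squares have ratio at most `1 + a/(n+1)`, hence at most `((n+2)/(n+1)) ^ a` by
Bernoulli, and the product telescopes. -/
theorem laguerreNorm_le {α : ℝ} (hα : -1 < α) {a : ℕ} (ha : α ≤ a) (n : ℕ) :
    laguerreNorm α n ≤ ((n : ℝ) + 1) ^ a := by
  have h : laguerreNorm α n ^ 2 ≤ ((n : ℝ) + 1) ^ a := by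
    rw [laguerreNorm_sq hα]
    induction n with
    | zero => simp [pochhammerSymbol]
    | succ n ih =>
      have hn : (0 : ℝ) ≤ n := n.cast_nonneg
      have hb := one_add_mul_le_pow (a := 1 / ((n : ℝ) + 1)) (by
        have : 0 ≤ 1 / ((n : ℝ) + 1) := by positivity
        linarith) a
      rw [pochhammerSymbol_succ, Nat.factorial_succ]
      calc pochhammerSymbol (α + 1) n * (α + 1 + n) / ((n + 1) * n.factorial : ℕ)
          = pochhammerSymbol (α + 1) n / n.factorial * ((α + 1 + n) / (n + 1)) := by
            push_cast; field_simp
        _ ≤ ((n : ℝ) + 1) ^ a * (1 + a * (1 / ((n : ℝ) + 1))) := by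
            gcongr
            · exact div_nonneg (by linarith) (by positivity)
            · rw [div_le_iff₀ (by positivity)]; field_simp; linarith
        _ ≤ ((n : ℝ) + 1) ^ a * (1 + 1 / ((n : ℝ) + 1)) ^ a := by gcongr
        _ = _ := by
            rw [← mul_pow]; congr 1; push_cast; field_simp
  have h1 : (1 : ℝ) ≤ ((n : ℝ) + 1) ^ a := one_le_pow₀ (by simp)
  refine le_of_sq_le_sq ?_ (by linarith)
  nlinarith

theorem exists_norm_laguerreKernel_le {α : ℝ} (hα : -1 < α) (n : ℕ) (R : ℝ) :
    ∃ (C ρ : ℝ) (d : ℕ), 0 ≤ C ∧ 0 < ρ ∧ ρ < 1 ∧ ∀ t, |t| ≤ R → ∀ m : ℕ,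
      ‖laguerreKernel α t n m‖ ≤ C * ((m : ℝ) + 1) ^ d * ρ ^ m := by
  obtain ⟨a, ha⟩ := exists_nat_ge α
  set ρ := Real.sqrt ((1 + R ^ 2) / (2 + R ^ 2)) with hρ
  have hρ0 : 0 < ρ := Real.sqrt_pos.2 (by positivity)
  have hρ1 : ρ < 1 := by
    rw [hρ, Real.sqrt_lt' one_pos, one_pow, div_lt_one (by positivity)]; linarith
  set W : ℝ := ∑ k ∈ Finset.range (n + 1),
    (n.choose k * (k.factorial / pochhammerSymbol (α + 1) k) * 4 ^ k) with hW
  have hW0 : 0 ≤ W := Finset.sum_nonneg fun k _ => by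
    have := pochhammerSymbol_pos (show 0 < α + 1 by linarith) k
    positivity
  have hc := laguerreNorm_pos hα n
  refine ⟨laguerreNorm α n * (W * (ρ ^ n)⁻¹), ρ, a + n, by positivity, hρ0, hρ1,
    fun t ht m => ?_⟩
  have hr : ‖laguerreOrbit t‖ ≤ ρ := norm_laguerreOrbit_le ht
  have hr1 : ‖1 + laguerreOrbit t‖ ≤ 2 := by
    calc _ ≤ ‖(1 : ℂ)‖ + ‖laguerreOrbit t‖ := norm_add_le _ _
      _ ≤ 2 := by rw [norm_one]; linarith
  have hS : ‖meixnerSum α n m (laguerreOrbit t)‖ ≤ W * (((m : ℝ) + 1) ^ n * ((ρ ^ n)⁻¹ * ρ ^ m)) := by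
    rw [hW, Finset.sum_mul]
    refine (norm_sum_le _ _).trans (Finset.sum_le_sum fun k hk => ?_)
    have hk : k ≤ n := by have := Finset.mem_range.1 hk; omega
    have hp := pochhammerSymbol_pos (show 0 < α + 1 by linarith) k
    have hch : (m.choose k : ℝ) ≤ ((m : ℝ) + 1) ^ n := by
      calc (m.choose k : ℝ) ≤ (m : ℝ) ^ k := by exact_mod_cast Nat.choose_le_pow m k
        _ ≤ ((m : ℝ) + 1) ^ k := by gcongr; linarith
        _ ≤ _ := pow_le_pow_right₀ (by simp) hk
    -- This also covers `m < k`, where the truncated exponent is `0`.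
    have hpow : ρ ^ (m - k) ≤ (ρ ^ n)⁻¹ * ρ ^ m := by
      rw [inv_mul_eq_div, le_div_iff₀ (by positivity), ← pow_add]
      exact pow_le_pow_of_le_one hρ0.le hρ1.le (by omega)
    rw [norm_mul, norm_mul, norm_mul, norm_pow, norm_pow, norm_pow, norm_pow,
      Complex.norm_of_nonneg (meixnerWeight_nonneg hα n m k), meixnerWeight]
    calc _ ≤ (n.choose k : ℝ) * ((m : ℝ) + 1) ^ n * (k.factorial / pochhammerSymbol (α + 1) k) *
        (1 * ((ρ ^ n)⁻¹ * ρ ^ m) * 4 ^ k) := by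
          gcongr
          · exact pow_le_one₀ (norm_nonneg _) (hr.trans hρ1.le)
          · exact (pow_le_pow_left₀ (norm_nonneg _) hr _).trans hpow
          · nlinarith [norm_nonneg (1 + laguerreOrbit t)]
      _ = _ := by ring
  rw [laguerreKernel, norm_mul, norm_mul, norm_mul, Complex.norm_of_nonneg hc.le,
    Complex.norm_of_nonneg (laguerreNorm_pos hα m).le]
  calc _ ≤ 1 * laguerreNorm α n * ((m : ℝ) + 1) ^ a *
        (W * (((m : ℝ) + 1) ^ n * ((ρ ^ n)⁻¹ * ρ ^ m))) := by
        gcongr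
        · exact (laguerreNorm_pos hα m).le
        · exact norm_one_add_I_mul_cpow_le hα t
        · exact laguerreNorm_le hα ha m
    _ = _ := by rw [pow_add]; ring

/-! ### Agreement with the Jacobi polynomial formula -/

/-- The root is `c m / c n`. Since `n + β = m`, the second binomial is an ordinary one, while the
first is `(α+1+k)_(n-k) / (n-k)!`, a quotient of Pochhammer symbols. -/
theorem laguerreNorm_mul_jacobi_coeff {α : ℝ} (hα : -1 < α) {n m k : ℕ} (hk : k ≤ n) :
    Real.sqrt ((pochhammerSymbol (α + 1) m * (n.factorial : ℝ)) /
        (pochhammerSymbol (α + 1) n * (m.factorial : ℝ))) *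
      (realBinom (n + α) (n - k) * realBinom (n + ((m : ℝ) - n)) k) =
    laguerreNorm α n * laguerreNorm α m * meixnerWeight α n m k := by
  have hpm := pochhammerSymbol_pos (show 0 < α + 1 by linarith) m
  have hpn := pochhammerSymbol_pos (show 0 < α + 1 by linarith) n
  have hpk := pochhammerSymbol_pos (show 0 < α + 1 by linarith) k
  have hs : Real.sqrt ((pochhammerSymbol (α + 1) m * (n.factorial : ℝ)) /
        (pochhammerSymbol (α + 1) n * (m.factorial : ℝ))) =
      laguerreNorm α m / laguerreNorm α n := by
    rw [laguerreNorm, laguerreNorm, ← Real.sqrt_div (by positivity)]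
    congr 1
    field_simp
  have hn := laguerreNorm_pos hα n
  have hsq := laguerreNorm_sq hα n
  have hadd := pochhammerSymbol_add (α + 1) k (n - k)
  rw [Nat.add_sub_cancel' hk] at hadd
  have hfac : (n.choose k : ℝ) * k.factorial * (n - k).factorial = n.factorial := by
    exact_mod_cast Nat.choose_mul_factorial_mul_factorial hk
  rw [hs, add_sub_cancel, realBinom_natCast, realBinom, Nat.cast_sub hk,
    show (n : ℝ) + α - (n - k) + 1 = α + 1 + k by ring, meixnerWeight]
  have hsq' : laguerreNorm α n ^ 2 * n.factorial =
      pochhammerSymbol (α + 1) k * pochhammerSymbol (α + 1 + k) (n - k) := by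
    rw [hsq, ← hadd]; field_simp
  have h1 : ((n - k).factorial : ℝ) ≠ 0 := by positivity
  field_simp
  rw [← hfac] at hsq'
  have h2 : (k.factorial : ℝ) ≠ 0 := by positivity
  linear_combination -(laguerreNorm α m * m.choose k) * hsq'

theorem laguerreKernel_eq_jacobi {α : ℝ} (hα : -1 < α) (t : ℝ) (n m : ℕ) :
    laguerreKernel α t n m =
          1 / (1 + Complex.I * (t : ℂ)) ^ ((1 + α : ℝ) : ℂ)
            * (((t : ℂ) + Complex.I) / ((t : ℂ) - Complex.I)) ^ n
            * (-((t : ℂ) / ((t : ℂ) - Complex.I))) ^ ((m : ℤ) - (n : ℤ))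
            * (Real.sqrt ((pochhammerSymbol (α + 1) m * (Nat.factorial n : ℝ)) /
                (pochhammerSymbol (α + 1) n * (Nat.factorial m : ℝ))) : ℂ)
            * (jacobiP n α ((m : ℝ) - (n : ℝ)) ((t ^ 2 - 1) / (t ^ 2 + 1)) : ℂ) := by
  -- In this case the orbit is at `0`, and Lean's `0 ^ (m - n)` is `0` for every nonzero integer
  -- exponent, as the off-diagonal identity kernel requires.
  by_cases hdeg : t = 0 ∧ n ≠ m
  · obtain ⟨rfl, hnm⟩ := hdeg
    have : (m : ℤ) - n ≠ 0 := by omega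
    rw [laguerreKernel_zero hα, if_neg hnm]
    simp [zero_zpow _ this]
  have hI := ofReal_sub_I_ne_zero t
  have hI' : (t : ℂ) + Complex.I ≠ 0 := fun h => by simpa using congrArg Complex.im h
  have ht2 : (t : ℂ) ^ 2 + 1 ≠ 0 := by
    have : ((t ^ 2 + 1 : ℝ) : ℂ) ≠ 0 := Complex.ofReal_ne_zero.2 (by positivity)
    exact_mod_cast this
  have hfac : (t : ℂ) ^ 2 + 1 = (t + Complex.I) * (t - Complex.I) := by
    linear_combination Complex.I_sq
  set s : ℂ := ((t : ℂ) + Complex.I) / ((t : ℂ) - Complex.I) with hs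
  -- The factor `s ^ n` is shared out as `s ^ k * s ^ (n-k)`: one `s` turns the two Jacobi factors
  -- into `(1+r)²` and `r²`.
  have hs1 : s * (((((t : ℂ) ^ 2 - 1) / (t ^ 2 + 1)) - 1) / 2) = (1 + laguerreOrbit t) ^ 2 := by
    rw [one_add_laguerreOrbit, div_sub_one ht2, hfac, hs]
    field_simp
    linear_combination -Complex.I_sq
  have hs2 : s * (((((t : ℂ) ^ 2 - 1) / (t ^ 2 + 1)) + 1) / 2) = laguerreOrbit t ^ 2 := by
    rw [laguerreOrbit, div_add_one ht2, hfac, hs]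
    field_simp
    linear_combination -Complex.I_sq
  rw [laguerreKernel, meixnerSum, Complex.cpow_neg, ← one_div, jacobiP, Complex.ofReal_sum]
  change _ = _ * _ * laguerreOrbit t ^ ((m : ℤ) - n) * _ * _
  simp only [Finset.mul_sum]
  refine Finset.sum_congr rfl fun k hk => ?_
  have hk : k ≤ n := by have := Finset.mem_range.1 hk; omega
  have hc := congrArg (fun x : ℝ => (x : ℂ)) (laguerreNorm_mul_jacobi_coeff hα (m := m) hk)
  rcases lt_or_ge m k with hmk | hmk
  · rw [meixnerWeight_of_lt _ _ hmk] at hc ⊢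
    push_cast at hc ⊢
    linear_combination -(1 / (1 + Complex.I * (t : ℂ)) ^ (1 + α : ℂ) * s ^ n *
      laguerreOrbit t ^ ((m : ℤ) - n) * ((((t : ℂ) ^ 2 - 1) / (t ^ 2 + 1) - 1) / 2) ^ k *
      ((((t : ℂ) ^ 2 - 1) / (t ^ 2 + 1) + 1) / 2) ^ (n - k)) * hc
  have hpow : laguerreOrbit t ^ ((m : ℤ) - n) * (laguerreOrbit t ^ 2) ^ (n - k) =
      laguerreOrbit t ^ (n - k) * laguerreOrbit t ^ (m - k) := by
    rcases eq_or_ne n m with rfl | hnm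
    · simp [← pow_mul, ← pow_add, two_mul]
    · have ht : (t : ℂ) ≠ 0 := Complex.ofReal_ne_zero.2 fun h => hdeg ⟨h, hnm⟩
      have hr : laguerreOrbit t ≠ 0 := neg_ne_zero.2 (div_ne_zero ht hI)
      rw [← pow_mul, ← pow_add, ← zpow_natCast, ← zpow_natCast, ← zpow_add₀ hr]
      congr 1
      push_cast [Nat.cast_sub hk, Nat.cast_sub hmk]
      ring
  have hsn : s ^ n = s ^ k * s ^ (n - k) := by rw [← pow_add, Nat.add_sub_cancel' hk]
  rw [← hs1]
  rw [← hs2] at hpow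
  simp only [mul_pow] at hpow ⊢
  rw [hsn]
  push_cast at hc ⊢
  linear_combination (-(1 / (1 + Complex.I * (t : ℂ)) ^ (1 + α : ℂ) * s ^ k * s ^ (n - k) *
      laguerreOrbit t ^ ((m : ℤ) - n) * ((((t : ℂ) ^ 2 - 1) / (t ^ 2 + 1) - 1) / 2) ^ k *
      ((((t : ℂ) ^ 2 - 1) / (t ^ 2 + 1) + 1) / 2) ^ (n - k))) * hc -
    (1 / (1 + Complex.I * (t : ℂ)) ^ (1 + α : ℂ) * laguerreNorm α n * laguerreNorm α m *
      meixnerWeight α n m k * s ^ k * ((((t : ℂ) ^ 2 - 1) / (t ^ 2 + 1) - 1) / 2) ^ k) * hpow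

/-! ### Uniqueness of evolution groups -/

namespace IsEvolutionGroup

variable {E : Type*} [NormedAddCommGroup E] [InnerProductSpace ℂ E] [CompleteSpace E]
  {A : E →ₗ.[ℂ] E} {U V : ℝ → E →L[ℂ] E}

theorem inner_map_map (hU : IsEvolutionGroup A U) (t : ℝ) (u v : E) :
    ⟪U t u, U t v⟫_ℂ = ⟪u, v⟫_ℂ := by
  rw [← ContinuousLinearMap.adjoint_inner_right, ← ContinuousLinearMap.star_eq_adjoint,
    ← mul_apply_eq_comp, (Unitary.mem_iff.1 (hU.unitary t)).1,
    one_apply_eq_self]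

theorem hasDerivAt (hU : IsEvolutionGroup A U) {u v : E} (h : (u, v) ∈ A.graph) (t : ℝ) :
    HasDerivAt (fun s => U s u) (-(Complex.I • U t v)) t := by
  have h0 := (hU.generator u v).1 h
  have h1 : HasDerivAt (fun s => U (s - t) u) (-(Complex.I • v)) t := by
    have := HasDerivAt.scomp t (h := fun s => s - t) (h' := (1 : ℝ)) (g₁ := fun s => U s u)
      (by simpa using h0) ((hasDerivAt_id t).sub_const t)
    rw [one_smul] at this
    exact this
  have h2 := ((U t).restrictScalars ℝ).hasFDerivAt.comp_hasDerivAt t h1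
  have h3 : (fun s => U s u) = ((U t).restrictScalars ℝ) ∘ fun s => U (s - t) u := by
    funext s
    change U s u = (U t * U (s - t)) u
    rw [← hU.map_add, add_sub_cancel]
  rw [h3]
  simpa using h2

theorem mem_graph (hU : IsEvolutionGroup A U) {u v : E} (h : (u, v) ∈ A.graph) (t : ℝ) :
    (U t u, U t v) ∈ A.graph := by
  rw [hU.generator]
  have h2 := ((U t).restrictScalars ℝ).hasFDerivAt.comp_hasDerivAt 0 ((hU.generator u v).1 h)
  have h3 : (fun s => U s (U t u)) = ((U t).restrictScalars ℝ) ∘ fun s => U s u := by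
    funext s
    change (U s * U t) u = (U t * U s) u
    rw [← hU.map_add, ← hU.map_add, add_comm]
  rw [h3]
  simpa using h2

/-- Skew-symmetry of the generator, from differentiating the constant `‖U s u‖²` at `0`. -/
theorem inner_add_inner_eq_zero (hU : IsEvolutionGroup A U) {u v : E} (h : (u, v) ∈ A.graph) :
    ⟪u, -(Complex.I • v)⟫_ℂ + ⟪-(Complex.I • v), u⟫_ℂ = 0 := by
  have h0 := (hU.generator u v).1 h
  have h1 := h0.inner ℂ h0
  simp only [hU.inner_map_map, hU.map_zero, one_apply_eq_self] at h1
  exact h1.unique (hasDerivAt_const _ _)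

/-- The difference of the two orbits stays in the domain and solves the same equation, so
skew-symmetry keeps its norm constant, and it starts at `0`. -/
theorem eq_on_domain (hU : IsEvolutionGroup A U) (hV : IsEvolutionGroup A V) {u v : E}
    (h : (u, v) ∈ A.graph) (t : ℝ) : U t u = V t u := by
  have hd (s : ℝ) := (hU.hasDerivAt h s).fun_sub (hV.hasDerivAt h s)
  have hc (s : ℝ) : HasDerivAt (fun s => ⟪U s u - V s u, U s u - V s u⟫_ℂ) 0 s := by
    refine ((hd s).inner ℂ (hd s)).congr_deriv ?_
    have h1 := hU.inner_add_inner_eq_zero (A.graph.sub_mem (hU.mem_graph h s) (hV.mem_graph h s))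
    rw [← h1]
    simp only [smul_sub, neg_sub, neg_sub_neg]
  have := is_const_of_deriv_eq_zero (fun s => (hc s).differentiableAt) (fun s => (hc s).deriv) t 0
  simp only [hU.map_zero, hV.map_zero, sub_self, inner_zero_left] at this
  exact sub_eq_zero.1 (inner_self_eq_zero.1 this)

end IsEvolutionGroup

/-! ### The difference expression and its summation by parts -/

theorem summable_pow_mul_geometric {ρ : ℝ} (h0 : 0 < ρ) (h1 : ρ < 1) (C : ℝ) (d : ℕ) :
    Summable fun k : ℕ => C * ((k : ℝ) + 1) ^ d * ρ ^ k := by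
  have h := (summable_nat_add_iff 1).2 (summable_pow_mul_geometric_of_norm_lt_one (R := ℝ) d
    (r := ρ) (by rwa [Real.norm_of_nonneg h0.le]))
  refine (h.mul_left (C * ρ⁻¹)).congr fun k => ?_
  push_cast
  field_simp
  ring

theorem sqrt_laguerre_le {α : ℝ} (k : ℕ) :
    Real.sqrt (((k : ℝ) + 1) * ((k : ℝ) + 1 + α)) ≤ (2 + |α|) * ((k : ℝ) + 1) := by
  have hk : (0 : ℝ) ≤ k := k.cast_nonneg
  have h1 := le_abs_self α
  have h2 := abs_nonneg α
  refine Real.sqrt_le_iff.2 ⟨by positivity, ?_⟩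
  have h3 : (k : ℝ) + 1 + α ≤ (2 + |α|) * ((k : ℝ) + 1) := by nlinarith
  have h4 : (k : ℝ) + 1 ≤ (2 + |α|) * ((k : ℝ) + 1) := by nlinarith
  calc _ ≤ ((k : ℝ) + 1) * ((2 + |α|) * ((k : ℝ) + 1)) := by gcongr
    _ ≤ _ := by rw [sq]; gcongr

/-- Linearly growing coefficients cost one power of `k + 1`; the neighbours `k - 1` and `k + 1` cost
`ρ⁻¹` and `2 ^ d`. -/
theorem norm_laguerreExpr_le {α C ρ : ℝ} {d : ℕ} (hC : 0 ≤ C) (h0 : 0 < ρ) (h1 : ρ < 1)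
    {u : ℕ → ℂ} (hu : ∀ k : ℕ, ‖u k‖ ≤ C * ((k : ℝ) + 1) ^ d * ρ ^ k) (k : ℕ) :
    ‖laguerreExpr α u k‖ ≤
      (2 + |α|) * C * (ρ⁻¹ + 1 + 2 ^ d) * ((k : ℝ) + 1) ^ (d + 1) * ρ ^ k := by
  have hk : (0 : ℝ) ≤ k := k.cast_nonneg
  have hα := abs_nonneg α
  set B := C * ((k : ℝ) + 1) ^ d * ρ ^ k with hB
  have hB0 : 0 ≤ B := by positivity
  have hmid : ‖((2 * (k : ℝ) + 1 + α : ℝ) : ℂ) * u k‖ ≤ (2 + |α|) * ((k : ℝ) + 1) * B := by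
    rw [norm_mul, Complex.norm_real, Real.norm_eq_abs]
    gcongr
    · rw [abs_le]; constructor <;> nlinarith [le_abs_self α, neg_abs_le α]
    · exact hu k
  have hup : ‖(Real.sqrt (((k : ℝ) + 1) * ((k : ℝ) + 1 + α)) : ℂ) * u (k + 1)‖ ≤
      (2 + |α|) * ((k : ℝ) + 1) * (2 ^ d * B) := by
    rw [norm_mul, Complex.norm_of_nonneg (Real.sqrt_nonneg _)]
    refine mul_le_mul (sqrt_laguerre_le k) ((hu (k + 1)).trans ?_) (norm_nonneg _) (by positivity)
    calc C * (((k + 1 : ℕ) : ℝ) + 1) ^ d * ρ ^ (k + 1)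
        ≤ C * (2 * ((k : ℝ) + 1)) ^ d * ρ ^ k := by
          have : ρ ^ (k + 1) ≤ ρ ^ k := pow_le_pow_of_le_one h0.le h1.le k.le_succ
          gcongr
          push_cast; linarith
      _ = 2 ^ d * B := by rw [mul_pow, hB]; ring
  have hsum (x y z : ℂ) (hx : ‖x‖ ≤ (2 + |α|) * ((k : ℝ) + 1) * (ρ⁻¹ * B))
      (hy : ‖y‖ ≤ (2 + |α|) * ((k : ℝ) + 1) * B)
      (hz : ‖z‖ ≤ (2 + |α|) * ((k : ℝ) + 1) * (2 ^ d * B)) :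
      ‖x + y + z‖ ≤ (2 + |α|) * C * (ρ⁻¹ + 1 + 2 ^ d) * ((k : ℝ) + 1) ^ (d + 1) * ρ ^ k := by
    calc ‖x + y + z‖ ≤ ‖x‖ + ‖y‖ + ‖z‖ := norm_add₃_le
      _ ≤ _ := add_le_add (add_le_add hx hy) hz
      _ = _ := by rw [hB]; ring
  rcases k with _ | j
  · rw [laguerreExpr_zero, ← zero_add (_ * u 0)]
    exact hsum _ _ _ (by rw [norm_zero]; positivity) hmid hup
  · rw [laguerreExpr_succ]
    refine hsum _ _ _ ?_ hmid hup
    rw [norm_mul, Complex.norm_of_nonneg (Real.sqrt_nonneg _)]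
    refine mul_le_mul ((sqrt_laguerre_le j).trans ?_) ((hu j).trans ?_) (norm_nonneg _)
      (by positivity)
    · gcongr
      simp
    · rw [hB, pow_succ ρ]
      calc C * ((j : ℝ) + 1) ^ d * ρ ^ j ≤ C * (((j + 1 : ℕ) : ℝ) + 1) ^ d * ρ ^ j := by
            gcongr
            simp
        _ = _ := by field_simp

theorem sum_range_laguerreExpr (α : ℝ) (φ u : ℕ → ℂ) (N : ℕ) :
    ∑ k ∈ Finset.range (N + 1), (starRingEnd ℂ) (φ k) * laguerreExpr α u k =
      ∑ k ∈ Finset.range (N + 1), (starRingEnd ℂ) (laguerreExpr α φ k) * u k -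
      Real.sqrt (((N : ℝ) + 1) * ((N : ℝ) + 1 + α)) *
        ((starRingEnd ℂ) (φ (N + 1)) * u N - (starRingEnd ℂ) (φ N) * u (N + 1)) := by
  induction N with
  | zero =>
    simp only [zero_add, Finset.sum_range_one, laguerreExpr_zero, map_add, map_mul,
      Complex.conj_ofReal]
    ring
  | succ N ih =>
    rw [Finset.sum_range_succ, ih, Finset.sum_range_succ _ (N + 1), laguerreExpr_succ,
      laguerreExpr_succ]
    simp only [map_add, map_mul, Complex.conj_ofReal]
    ring

/-- The decay of `φ` beats the linear growth of the boundary coefficient, so `u` need only be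
bounded there and may lie outside the domain. -/
theorem tendsto_sum_range_laguerreExpr {α : ℝ} {φ w : EllTwo} (hw : ∀ k, w k = laguerreExpr α φ k)
    (hφ : Filter.Tendsto (fun k : ℕ => ((k : ℝ) + 1) * ‖φ k‖) Filter.atTop (nhds 0))
    (u : EllTwo) :
    Filter.Tendsto
      (fun N => ∑ k ∈ Finset.range (N + 1), (starRingEnd ℂ) (φ k) * laguerreExpr α u k)
      Filter.atTop (nhds ⟪w, u⟫_ℂ) := by
  simp only [sum_range_laguerreExpr]
  rw [← sub_zero ⟪w, u⟫_ℂ]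
  refine Filter.Tendsto.sub ?_ ?_
  · have h := (lp.hasSum_inner (𝕜 := ℂ) w u).tendsto_sum_nat.comp (Filter.tendsto_add_atTop_nat 1)
    refine h.congr fun N => Finset.sum_congr rfl fun k _ => ?_
    rw [← hw, RCLike.inner_apply, mul_comm]
  · have hφ' := (Filter.tendsto_add_atTop_iff_nat 1).2 hφ
    have hlim := ((hφ'.add hφ).mul_const ‖u‖).const_mul (2 + |α|)
    rw [add_zero, zero_mul, mul_zero] at hlim
    refine squeeze_zero_norm (fun N => ?_) hlim
    have hα := abs_nonneg α
    have hu (k : ℕ) : ‖u k‖ ≤ ‖u‖ := lp.norm_apply_le_norm two_ne_zero u k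
    rw [norm_mul, Complex.norm_of_nonneg (Real.sqrt_nonneg _)]
    calc _ ≤ ((2 + |α|) * ((N : ℝ) + 1)) * (‖φ (N + 1)‖ * ‖u‖ + ‖φ N‖ * ‖u‖) := by
          gcongr
          · exact sqrt_laguerre_le N
          · refine (norm_sub_le _ _).trans ?_
            rw [norm_mul, norm_mul, RCLike.norm_conj, RCLike.norm_conj]
            gcongr <;> exact hu _
      _ ≤ (2 + |α|) * (((((N + 1 : ℕ) : ℝ) + 1) * ‖φ (N + 1)‖ + ((N : ℝ) + 1) * ‖φ N‖) * ‖u‖) := by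
          have h1 := norm_nonneg (φ (N + 1))
          have h2 := norm_nonneg u
          push_cast
          rw [mul_assoc]
          refine mul_le_mul_of_nonneg_left ?_ (by positivity)
          nlinarith [mul_nonneg h1 h2]

theorem inner_laguerreExpr {α : ℝ} {φ w u v : EllTwo} (hw : ∀ k, w k = laguerreExpr α φ k)
    (hv : ∀ k, v k = laguerreExpr α u k)
    (hφ : Filter.Tendsto (fun k : ℕ => ((k : ℝ) + 1) * ‖φ k‖) Filter.atTop (nhds 0)) :
    ⟪w, u⟫_ℂ = ⟪φ, v⟫_ℂ := by
  refine tendsto_nhds_unique (tendsto_sum_range_laguerreExpr hw hφ u) ?_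
  have h := (lp.hasSum_inner (𝕜 := ℂ) φ v).tendsto_sum_nat.comp (Filter.tendsto_add_atTop_nat 1)
  refine h.congr fun N => Finset.sum_congr rfl fun k _ => ?_
  rw [← hv, RCLike.inner_apply, mul_comm]

theorem mem_graph_laguerreOp {α : ℝ} {u v : EllTwo} :
    (u, v) ∈ (laguerreOp α).graph ↔ ∀ k, v k = laguerreExpr α u k := by
  rw [LinearPMap.mem_graph_iff]
  constructor
  · rintro ⟨y, rfl, rfl⟩ k
    rfl
  · intro h
    have hv : (v : ℕ → ℂ) = laguerreExpr α u := funext h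
    have hu : u ∈ (laguerreOp α).domain := by
      change Memℓp (laguerreExpr α u) 2
      rw [← hv]
      exact lp.memℓp v
    exact ⟨⟨u, hu⟩, rfl, Subtype.ext hv.symm⟩

/-! ### Coordinates and differentiation in `ℓ²` -/

theorem inner_delta_left (k : ℕ) (u : EllTwo) : ⟪delta k, u⟫_ℂ = u k := by
  rw [delta, lp.inner_single_left]; simp

theorem delta_apply (n k : ℕ) : delta n k = if n = k then 1 else 0 := by
  rw [delta, lp.single_apply]
  rcases eq_or_ne n k with rfl | h
  · simp
  · rw [if_neg h, Pi.single_eq_of_ne h.symm]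

theorem ellTwo_clm_ext {F : Type*} [AddCommMonoid F] [Module ℂ F] [TopologicalSpace F] [T2Space F]
    {f g : EllTwo →L[ℂ] F} (h : ∀ n, f (delta n) = g (delta n)) : f = g := by
  refine lp.ext_continuousLinearMap (by simp) fun n => ?_
  ext
  exact h n

theorem memℓp_two_of_summable {u : ℕ → ℂ} {b : ℕ → ℝ} (hb : Summable b)
    (h : ∀ k, ‖u k‖ ≤ b k) : Memℓp u 2 := by
  have h1 : Memℓp u 1 := memℓp_gen (by
    simpa using Summable.of_nonneg_of_le (fun k => norm_nonneg (u k)) h hb)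
  exact h1.of_exponent_ge (by norm_num)

/-- Termwise differentiation of the expansion in unit vectors, under a summable majorant, upgrades
coordinate derivatives to a norm derivative. -/
theorem hasDerivAt_ellTwo {φ φ' : ℝ → EllTwo} {b : ℕ → ℝ} {t R : ℝ} (ht : |t| < R)
    (hb : Summable b) (hd : ∀ s k, HasDerivAt (fun s => φ s k) (φ' s k) s)
    (hφ' : ∀ s, |s| ≤ R → ∀ k, ‖φ' s k‖ ≤ b k) : HasDerivAt φ (φ' t) t := by
  have hsum (u : EllTwo) := lp.hasSum_single (p := 2) (by simp) u
  have hmem : t ∈ Set.Ioo (-R) R := abs_lt.1 ht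
  have h := hasDerivAt_tsum_of_isPreconnected (𝕜 := ℝ)
    (g := fun k s => (lp.single 2 k (φ s k) : EllTwo))
    (g' := fun k s => (lp.single 2 k (φ' s k) : EllTwo)) hb isOpen_Ioo isPreconnected_Ioo
    (fun k s _ => ((lp.singleContinuousLinearMap ℂ (fun _ : ℕ => ℂ) 2 k).restrictScalars
      ℝ).hasFDerivAt.comp_hasDerivAt s (hd s k))
    (fun k s hs => by
      rw [lp.norm_single (by norm_num)]
      exact hφ' s (abs_lt.2 hs).le k)
    hmem (hsum (φ t)).summable hmem
  rw [(hsum (φ' t)).tsum_eq] at h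
  exact h.congr_of_eventuallyEq (Filter.Eventually.of_forall fun s => (hsum (φ s)).tsum_eq.symm)

/-! ### The evolution group of the discrete Laguerre operator -/

theorem exists_norm_laguerreKernel_and_laguerreExpr_le {α : ℝ} (hα : -1 < α) (n : ℕ) (R : ℝ) :
    ∃ b : ℕ → ℝ, Summable b ∧ ∀ t, |t| ≤ R → ∀ k : ℕ,
      ((k : ℝ) + 1) * ‖laguerreKernel α t n k‖ ≤ b k ∧
      ‖laguerreExpr α (laguerreKernel α t n) k‖ ≤ b k := by
  obtain ⟨C, ρ, d, hC, h0, h1, h⟩ := exists_norm_laguerreKernel_le hα n R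
  have hb1 := summable_pow_mul_geometric h0 h1 C (d + 1)
  have hb2 := summable_pow_mul_geometric h0 h1 ((2 + |α|) * C * (ρ⁻¹ + 1 + 2 ^ d)) (d + 1)
  have hα' := abs_nonneg α
  refine ⟨_, hb1.add hb2, fun t ht k => ⟨?_, ?_⟩⟩
  · refine le_trans ?_ (le_add_of_nonneg_right (by positivity))
    calc ((k : ℝ) + 1) * ‖laguerreKernel α t n k‖
        ≤ ((k : ℝ) + 1) * (C * ((k : ℝ) + 1) ^ d * ρ ^ k) := by gcongr; exact h t ht k
      _ = _ := by ring
  · exact (norm_laguerreExpr_le hC h0 h1 (h t ht) k).trans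
      (le_add_of_nonneg_left (by positivity))

theorem norm_le_add_one_mul_norm (k : ℕ) (z : ℂ) : ‖z‖ ≤ ((k : ℝ) + 1) * ‖z‖ :=
  le_mul_of_one_le_left (norm_nonneg z) (by simp)

/-- The column `e^{-itH_α} δ_n`. -/
def laguerreColumn {α : ℝ} (hα : -1 < α) (t : ℝ) (n : ℕ) : EllTwo :=
  ⟨laguerreKernel α t n, by
    obtain ⟨b, hb, h⟩ := exists_norm_laguerreKernel_and_laguerreExpr_le hα n |t|
    exact memℓp_two_of_summable hb fun k =>
      (norm_le_add_one_mul_norm k _).trans (h t le_rfl k).1⟩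

/-- The column `H_α e^{-itH_α} δ_n`. -/
def laguerreOpColumn {α : ℝ} (hα : -1 < α) (t : ℝ) (n : ℕ) : EllTwo :=
  ⟨laguerreExpr α (laguerreKernel α t n), by
    obtain ⟨b, hb, h⟩ := exists_norm_laguerreKernel_and_laguerreExpr_le hα n |t|
    exact memℓp_two_of_summable hb fun k => (h t le_rfl k).2⟩

section
variable {α : ℝ} (hα : -1 < α)

theorem laguerreColumn_apply (t : ℝ) (n k : ℕ) :
    laguerreColumn hα t n k = laguerreKernel α t n k := rfl

theorem laguerreOpColumn_apply (t : ℝ) (n k : ℕ) :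
    laguerreOpColumn hα t n k = laguerreExpr α (laguerreColumn hα t n) k := rfl

theorem laguerreColumn_zero (n : ℕ) : laguerreColumn hα 0 n = delta n := by
  ext k
  rw [laguerreColumn_apply, laguerreKernel_zero hα, delta_apply]

theorem tendsto_mul_norm_laguerreColumn (t : ℝ) (n : ℕ) :
    Filter.Tendsto (fun k : ℕ => ((k : ℝ) + 1) * ‖laguerreColumn hα t n k‖)
      Filter.atTop (nhds 0) := by
  obtain ⟨b, hb, h⟩ := exists_norm_laguerreKernel_and_laguerreExpr_le hα n |t|
  exact squeeze_zero (fun k => by positivity) (fun k => (h t le_rfl k).1)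
    hb.tendsto_atTop_zero

theorem hasDerivAt_laguerreColumn (t : ℝ) (n : ℕ) :
    HasDerivAt (fun t => laguerreColumn hα t n)
      (-(Complex.I • laguerreOpColumn hα t n)) t := by
  obtain ⟨b, hb, h⟩ := exists_norm_laguerreKernel_and_laguerreExpr_le hα n (|t| + 1)
  refine hasDerivAt_ellTwo (φ' := fun t => -(Complex.I • laguerreOpColumn hα t n))
    (lt_add_one |t|) hb (fun s k => hasDerivAt_laguerreKernel hα s n k) fun s hs k => ?_
  rw [lp.coeFn_neg, Pi.neg_apply, norm_neg, lp.coeFn_smul, Pi.smul_apply, norm_smul,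
    Complex.norm_I, one_mul]
  exact (h s hs k).2

/-- Symmetry of `τ_α` on decaying columns makes the left side independent of `s`; at `s = 0` the
first column is a unit vector. The case `r = 0` gives orthonormality, general `r` the group law. -/
theorem inner_laguerreColumn (r s : ℝ) (n m : ℕ) :
    ⟪laguerreColumn hα s n, laguerreColumn hα (s - r) m⟫_ℂ = laguerreKernel α (-r) m n := by
  have hd (s : ℝ) : HasDerivAt
      (fun s => ⟪laguerreColumn hα s n, laguerreColumn hα (s - r) m⟫_ℂ) 0 s := by
    have h2 : HasDerivAt (fun s => laguerreColumn hα (s - r) m)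
        (-(Complex.I • laguerreOpColumn hα (s - r) m)) s := by
      have := (hasDerivAt_laguerreColumn hα (s - r) m).scomp s ((hasDerivAt_id s).sub_const r)
      rw [one_smul] at this
      exact this
    refine ((hasDerivAt_laguerreColumn hα s n).inner ℂ h2).congr_deriv ?_
    rw [inner_neg_left, inner_neg_right, inner_smul_left, inner_smul_right, Complex.conj_I,
      inner_laguerreExpr (laguerreOpColumn_apply hα s n) (laguerreOpColumn_apply hα (s - r) m)
        (tendsto_mul_norm_laguerreColumn hα s n)]
    ring
  have := is_const_of_deriv_eq_zero (fun s => (hd s).differentiableAt) (fun s => (hd s).deriv) s 0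
  simpa only [laguerreColumn_zero, inner_delta_left, zero_sub, laguerreColumn_apply] using this

theorem orthonormal_laguerreColumn (t : ℝ) : Orthonormal ℂ (laguerreColumn hα t) := by
  rw [orthonormal_iff_ite]
  intro n m
  have := inner_laguerreColumn hα 0 t n m
  rw [sub_zero, neg_zero, laguerreKernel_zero hα] at this
  simpa [eq_comm] using this

/-- The evolution group `e^{-itH_α}`. -/
def laguerreEvolution (t : ℝ) : EllTwo →L[ℂ] EllTwo :=
  (orthonormal_laguerreColumn hα t).orthogonalFamily.linearIsometry.toContinuousLinearMap

theorem laguerreEvolution_delta (t : ℝ) (n : ℕ) :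
    laguerreEvolution hα t (delta n) = laguerreColumn hα t n := by
  rw [laguerreEvolution, LinearIsometry.coe_toContinuousLinearMap, delta,
    OrthogonalFamily.linearIsometry_apply_single]
  simp

theorem norm_laguerreEvolution (t : ℝ) (u : EllTwo) : ‖laguerreEvolution hα t u‖ = ‖u‖ :=
  LinearIsometry.norm_map _ _

theorem kernel_laguerreEvolution (t : ℝ) (n m : ℕ) :
    kernel (laguerreEvolution hα t) n m = laguerreKernel α t n m := by
  rw [kernel, laguerreEvolution_delta, inner_delta_left, laguerreColumn_apply]

theorem star_laguerreEvolution (t : ℝ) :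
    star (laguerreEvolution hα t) = laguerreEvolution hα (-t) := by
  refine ellTwo_clm_ext fun n => ?_
  ext k
  rw [← inner_delta_left, ContinuousLinearMap.star_eq_adjoint,
    ContinuousLinearMap.adjoint_inner_right, laguerreEvolution_delta, laguerreEvolution_delta,
    laguerreColumn_apply, ← inner_conj_symm, inner_delta_left, laguerreColumn_apply,
    conj_laguerreKernel, laguerreKernel_comm]

theorem inner_laguerreEvolution_right (t : ℝ) (u v : EllTwo) :
    ⟪u, laguerreEvolution hα t v⟫_ℂ = ⟪laguerreEvolution hα (-t) u, v⟫_ℂ := by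
  rw [← star_laguerreEvolution, ContinuousLinearMap.star_eq_adjoint,
    ContinuousLinearMap.adjoint_inner_left]

theorem laguerreEvolution_apply (t : ℝ) (u : EllTwo) (k : ℕ) :
    laguerreEvolution hα t u k = ⟪laguerreColumn hα (-t) k, u⟫_ℂ := by
  rw [← inner_delta_left, inner_laguerreEvolution_right, laguerreEvolution_delta]

theorem laguerreEvolution_zero : laguerreEvolution hα 0 = 1 :=
  ellTwo_clm_ext fun n => by
    rw [laguerreEvolution_delta, laguerreColumn_zero, one_apply_eq_self]

theorem laguerreEvolution_add (s t : ℝ) :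
    laguerreEvolution hα (s + t) = laguerreEvolution hα s * laguerreEvolution hα t := by
  refine ellTwo_clm_ext fun n => ?_
  ext k
  have h := inner_laguerreColumn hα (-s - t) (-s) k n
  rw [mul_apply_eq_comp, laguerreEvolution_delta, laguerreEvolution_delta, laguerreColumn_apply,
    laguerreEvolution_apply]
  rw [show -s - (-s - t) = t by ring, show -(-s - t) = s + t by ring] at h
  exact h.symm

theorem laguerreEvolution_mem_unitary (t : ℝ) :
    laguerreEvolution hα t ∈ unitary (EllTwo →L[ℂ] EllTwo) := by
  rw [Unitary.mem_iff, star_laguerreEvolution, ← laguerreEvolution_add, ← laguerreEvolution_add,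
    neg_add_cancel, add_neg_cancel, laguerreEvolution_zero]
  exact ⟨rfl, rfl⟩

theorem continuous_laguerreEvolution (u : EllTwo) :
    Continuous fun t => laguerreEvolution hα t u := by
  have hsum := lp.hasSum_single (p := 2) (by simp) u
  -- The operators are isometric, so finite truncations of `u` converge uniformly in `t`.
  have hunif : TendstoUniformly (fun (S : Finset ℕ) t =>
      laguerreEvolution hα t (∑ i ∈ S, lp.single 2 i (u i)))
      (fun t => laguerreEvolution hα t u) Filter.atTop := by
    rw [Metric.tendstoUniformly_iff]
    intro ε hε
    filter_upwards [(Metric.tendsto_nhds.1 hsum) ε hε] with S hS t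
    rwa [dist_eq_norm, ← map_sub, norm_laguerreEvolution, ← dist_eq_norm, dist_comm]
  refine hunif.continuous (Filter.Eventually.frequently (Filter.Eventually.of_forall fun S => ?_))
  simp only [map_sum]
  refine continuous_finsetSum _ fun i _ => ?_
  have h (t : ℝ) : laguerreEvolution hα t (lp.single 2 i (u i)) = u i • laguerreColumn hα t i := by
    rw [← laguerreEvolution_delta, ← map_smul, delta, ← lp.single_smul, smul_eq_mul, mul_one]
  simp only [h]
  exact (continuous_iff_continuousAt.2 fun t =>
    (hasDerivAt_laguerreColumn hα t i).continuousAt).const_smul (u i)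

theorem hasDerivAt_laguerreEvolution_apply (u : EllTwo) (t : ℝ) (k : ℕ) :
    HasDerivAt (fun t => laguerreEvolution hα t u k)
      (-(Complex.I * ⟪laguerreOpColumn hα (-t) k, u⟫_ℂ)) t := by
  simp only [laguerreEvolution_apply]
  have h1 : HasDerivAt (fun t => laguerreColumn hα (-t) k)
      (Complex.I • laguerreOpColumn hα (-t) k) t := by
    have := (hasDerivAt_laguerreColumn hα (-t) k).scomp t (hasDerivAt_neg t)
    rw [neg_smul, one_smul, neg_neg] at this
    exact this
  refine (h1.inner ℂ (hasDerivAt_const t u)).congr_deriv ?_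
  rw [inner_zero_right, zero_add, inner_smul_left, Complex.conj_I, neg_mul]

theorem inner_laguerreOpColumn_zero (u : EllTwo) (k : ℕ) :
    ⟪laguerreOpColumn hα 0 k, u⟫_ℂ = laguerreExpr α u k := by
  refine tendsto_nhds_unique (tendsto_sum_range_laguerreExpr (laguerreOpColumn_apply hα 0 k)
    (tendsto_mul_norm_laguerreColumn hα 0 k) u) (tendsto_const_nhds.congr' ?_)
  filter_upwards [Filter.eventually_ge_atTop k] with N hN
  rw [laguerreColumn_zero, Finset.sum_eq_single k]
  · simp [delta_apply]
  · intro j _ hj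
    simp [delta_apply, hj.symm]
  · intro h
    exact absurd (Finset.mem_range.2 (by omega)) h

theorem hasDerivAt_apply {φ : ℝ → EllTwo} {φ' : EllTwo} {t : ℝ} (h : HasDerivAt φ φ' t) (k : ℕ) :
    HasDerivAt (fun s => φ s k) (φ' k) t := by
  have := (hasDerivAt_const t (delta k)).inner ℂ h
  simpa only [inner_delta_left, inner_zero_left, add_zero] using this

/-- For `u` in the maximal domain only coordinates are known to be differentiable. The integrated
equation can be checked coordinatewise, and its right side is differentiable in norm. -/
theorem laguerreEvolution_eq_sub_integral {u v : EllTwo} (h : ∀ k, v k = laguerreExpr α u k)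
    (t : ℝ) :
    laguerreEvolution hα t u = u - Complex.I • ∫ s in (0 : ℝ)..t, laguerreEvolution hα s v := by
  have hint (t : ℝ) := (continuous_laguerreEvolution hα v).integral_hasStrictDerivAt 0 t
  ext k
  have hd (t : ℝ) : HasDerivAt (fun t => (laguerreEvolution hα t u +
      Complex.I • ∫ s in (0 : ℝ)..t, laguerreEvolution hα s v) k) 0 t := by
    have h1 := hasDerivAt_apply ((hint t).hasDerivAt.const_smul Complex.I) k
    refine ((hasDerivAt_laguerreEvolution_apply hα u t k).fun_add h1).congr_deriv ?_
    rw [inner_laguerreExpr (laguerreOpColumn_apply hα (-t) k) h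
      (tendsto_mul_norm_laguerreColumn hα (-t) k), ← laguerreEvolution_apply, lp.coeFn_smul,
      Pi.smul_apply, smul_eq_mul, neg_add_cancel]
  have := is_const_of_deriv_eq_zero (fun t => (hd t).differentiableAt) (fun t => (hd t).deriv) t 0
  rw [intervalIntegral.integral_same, smul_zero, add_zero, laguerreEvolution_zero,
    one_apply_eq_self, lp.coeFn_add, Pi.add_apply] at this
  rw [lp.coeFn_sub, Pi.sub_apply, ← this, add_sub_cancel_right]

theorem isEvolutionGroup_laguerreEvolution :
    IsEvolutionGroup (laguerreOp α) (laguerreEvolution hα) where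
  map_zero := laguerreEvolution_zero hα
  map_add := laguerreEvolution_add hα
  unitary := laguerreEvolution_mem_unitary hα
  continuous := continuous_laguerreEvolution hα
  generator u v := by
    rw [mem_graph_laguerreOp]
    constructor
    · intro h
      simp only [laguerreEvolution_eq_sub_integral hα h]
      have hint := (continuous_laguerreEvolution hα v).integral_hasStrictDerivAt 0 0
      refine ((hint.hasDerivAt.const_smul Complex.I).const_sub u).congr_deriv ?_
      rw [laguerreEvolution_zero, one_apply_eq_self]
    -- Coordinates of the orbit have derivative `-i (τ_α u) k` at `0` for every `u` in `ℓ²`; a norm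
    -- derivative must agree with them, which forces `v = τ_α u`.
    · intro h k
      have h1 := hasDerivAt_apply h k
      have h2 := hasDerivAt_laguerreEvolution_apply hα u 0 k
      rw [neg_zero, inner_laguerreOpColumn_zero] at h2
      have h3 := h1.unique h2
      rw [lp.coeFn_neg, Pi.neg_apply, neg_inj] at h3
      exact mul_left_cancel₀ Complex.I_ne_zero h3

theorem delta_mem_graph_laguerreOp (n : ℕ) :
    (delta n, laguerreOpColumn hα 0 n) ∈ (laguerreOp α).graph := by
  rw [mem_graph_laguerreOp, ← laguerreColumn_zero hα]
  exact laguerreOpColumn_apply hα 0 n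

theorem eq_laguerreEvolution {U : ℝ → EllTwo →L[ℂ] EllTwo}
    (hU : IsEvolutionGroup (laguerreOp α) U) : U = laguerreEvolution hα :=
  funext fun t => ellTwo_clm_ext fun n =>
    hU.eq_on_domain (isEvolutionGroup_laguerreEvolution hα) (delta_mem_graph_laguerreOp hα n) t

end

end
theorem theorem3p1 (α : ℝ) (hα : -1 < α) :
    (∃! U : ℝ → EllTwo →L[ℂ] EllTwo, IsEvolutionGroup (laguerreOp α) U) ∧
    ∀ U : ℝ → EllTwo →L[ℂ] EllTwo, IsEvolutionGroup (laguerreOp α) U →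
      ∀ (t : ℝ) (n m : ℕ),
        kernel (U t) n m = kernel (U t) m n ∧
        kernel (U t) n m =
          1 / (1 + Complex.I * (t : ℂ)) ^ ((1 + α : ℝ) : ℂ)
            * (((t : ℂ) + Complex.I) / ((t : ℂ) - Complex.I)) ^ n
            * (-((t : ℂ) / ((t : ℂ) - Complex.I))) ^ ((m : ℤ) - (n : ℤ))
            * (Real.sqrt ((pochhammerSymbol (α + 1) m * (Nat.factorial n : ℝ)) /
                (pochhammerSymbol (α + 1) n * (Nat.factorial m : ℝ))) : ℂ)
            * (jacobiP n α ((m : ℝ) - (n : ℝ)) ((t ^ 2 - 1) / (t ^ 2 + 1)) : ℂ) := by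
  refine ⟨⟨laguerreEvolution hα, isEvolutionGroup_laguerreEvolution hα,
    fun U hU => eq_laguerreEvolution hα hU⟩, fun U hU t n m => ?_⟩
  rw [eq_laguerreEvolution hα hU, kernel_laguerreEvolution, kernel_laguerreEvolution]
  exact ⟨laguerreKernel_comm α t n m, laguerreKernel_eq_jacobi hα t n m⟩
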